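/- Let $a>b>0$ and consider the confocal pencil of conics in the plane $$C_\lambda:\ \frac{x^2}{a-\lambda}+\frac{y^2}{b-\lambda}=1 .$$ For $\lambda\in(-\infty,b)\cup(b,a)$ define its rotation number (with respect to $C_0$) by $$\rho(\lambda)=\frac{\displaystyle\int_0^{\min\{b,\lambda\}}\frac{dt}{\sqrt{|(\lambda-t)(b-t)(a-t)|}}}{\displaystyle 2\int_{\max\{b,\lambda\}}^{a}\frac{dt}{\sqrt{|(\lambda-t)(b-t)(a-t)|}}},$$ where the integrals are oriented. For $\lambda\ge 0$ the product $(\lambda-t)(b-t)(a-t)$ is nonnegative on both intervals of integration, and the absolute values can be omitted; for $\lambda<0$ they matter only in the numerator, where the product is negative on $(\lambda,0)$, and the numerator is then negative. Then for every $\lambda\in(-\infty,b)\cup(b,a)$ both integrals converge and the denominator is positive, and $\rho$ is strictly monotonic on each of the intervals $(-\infty,b)$ and $(b,a)$. -/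

import Mathlib

open Set MeasureTheory

/-- The cubic `(l - t) (b - t) (a - t)` under the square root, for the conic `C_l` of the confocal
pencil `x² / (a - l) + y² / (b - l) = 1`. -/
def pencilCubic (a b l t : ℝ) : ℝ := (l - t) * (b - t) * (a - t)

/-- The integrand `1 / √|(l - t) (b - t) (a - t)|`. On both intervals of integration the cubic is
nonnegative, so that the absolute value is redundant, except on `[l, 0]` when `l < 0`: there the
cubic is negative, and the modulus of its square root is taken
(see `rotationNumber_eq_of_nonneg`). -/
noncomputable def rotationIntegrand (a b l t : ℝ) : ℝ := 1 / √|pencilCubic a b l t|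

/-- The rotation number `ρ(l) = ρ(l, a, b)`. The integrals are oriented, so that the numerator
is negative for `l < 0`. -/
noncomputable def rotationNumber (a b l : ℝ) : ℝ :=
  (∫ t in (0 : ℝ)..(min b l), rotationIntegrand a b l t) /
    (2 * ∫ t in (max b l)..a, rotationIntegrand a b l t)

/-- For `0 ≤ l ≤ a` the rotation number is given by the formula without absolute values. -/
theorem rotationNumber_eq_of_nonneg (a b l : ℝ) (hb : 0 < b) (hab : b < a)
    (hl : 0 ≤ l) (hla : l ≤ a) :
    rotationNumber a b l =
      (∫ t in (0 : ℝ)..(min b l), 1 / √((l - t) * (b - t) * (a - t))) /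
        (2 * ∫ t in (max b l)..a, 1 / √((l - t) * (b - t) * (a - t))) := by
  unfold rotationNumber
  congr 1
  · refine intervalIntegral.integral_congr fun t ht => ?_
    rw [uIcc_of_le (le_min hb.le hl)] at ht
    have h1 := ht.2.trans (min_le_left _ _)
    have h2 := ht.2.trans (min_le_right _ _)
    have : 0 ≤ (l - t) * (b - t) * (a - t) :=
      mul_nonneg (mul_nonneg (by linarith) (by linarith)) (by linarith)
    simp only [rotationIntegrand, pencilCubic, abs_of_nonneg this]
  · congr 1
    refine intervalIntegral.integral_congr fun t ht => ?_
    rw [uIcc_of_le (max_le hab.le hla)] at ht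
    have h1 := (le_max_left _ _).trans ht.1
    have h2 := (le_max_right _ _).trans ht.1
    have : 0 ≤ (l - t) * (b - t) * (a - t) :=
      mul_nonneg (mul_nonneg_of_nonpos_of_nonpos (by linarith) (by linarith)) (by linarith [ht.2])
    simp only [rotationIntegrand, pencilCubic, abs_of_nonneg this]

/-! Write `N`, `D` for the numerator integral and the integral in the denominator, and `A` for the
integral over `(-∞, 0]`. The two real half-periods of the elliptic curve agree, which removes the
moving endpoint (`integrableOn_Iic_and_integral_Iic_eq`). For `0 ≤ l < b` this gives `N = D - A`, so
`2ρ = 1 - A / D`, where `A` decreases and `D` increases with `l`. For `b < l < a`, exchanging `b`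
and `l` gives `D = A + N`. Since `l / (l - t)` decreases in `l` for `t > 0` and increases for `t <
0`, `√l * N` decreases and `√l * A` increases, so `ρ` decreases. For `l ≤ 0`, the weight `√(a - l)`
makes both the nonpositive `N` and the positive `D` increase, so `N / D` increases. -/

/-! ### Integrability at the branch points -/

theorem intervalIntegrable_one_div_sqrt_abs_sub (c u v : ℝ) :
    IntervalIntegrable (fun t => 1 / √|t - c|) volume u v := by
  have h : (-1 : ℝ) < -(1 / 2) := by norm_num
  -- A real power of a negative base carries the factor `cos (-π / 2) = 0`, so each summand lives on
  -- one half-line only.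
  have h0 : IntervalIntegrable (fun t : ℝ => t ^ (-(1 / 2) : ℝ) + (-t) ^ (-(1 / 2) : ℝ))
      volume (u - c) (v - c) := by
    refine (intervalIntegral.intervalIntegrable_rpow' h).add ?_
    rw [IntervalIntegrable.iff_comp_neg]
    simpa only [neg_neg] using intervalIntegral.intervalIntegrable_rpow' h
  have h1 : (fun t : ℝ => t ^ (-(1 / 2) : ℝ) + (-t) ^ (-(1 / 2) : ℝ)) = fun t => 1 / √|t| := by
    have key : ∀ t : ℝ, 0 < t → t ^ (-(1 / 2) : ℝ) + (-t) ^ (-(1 / 2) : ℝ) = 1 / √t := by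
      intro t ht
      rw [Real.rpow_def_of_neg (neg_lt_zero.2 ht)]
      have : Real.cos (-(1 / 2) * Real.pi) = 0 := by
        rw [show -(1 / 2) * Real.pi = -(Real.pi / 2) by ring, Real.cos_neg, Real.cos_pi_div_two]
      rw [this, mul_zero, add_zero, Real.rpow_neg ht.le, Real.sqrt_eq_rpow]
      exact (one_div _).symm
    funext t
    rcases lt_trichotomy t 0 with ht | rfl | ht
    · have := key (-t) (by linarith)
      rw [neg_neg] at this
      rw [abs_of_neg ht, ← this, add_comm]
    · simp
    · rw [abs_of_pos ht, key t ht]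
  rw [h1] at h0
  simpa using h0.comp_sub_right c

theorem one_div_sqrt_mul_le {δ x y : ℝ} (hδ : 0 < δ) (hx : 0 ≤ x) (hy : δ ^ 2 ≤ y) :
    1 / √(x * y) ≤ δ⁻¹ * (1 / √x) := by
  rw [Real.sqrt_mul hx, ← one_div_mul_one_div, mul_comm, ← one_div]
  gcongr
  exact Real.le_sqrt_of_sq_le hy

theorem measurable_rotationIntegrand (a b l : ℝ) : Measurable (rotationIntegrand a b l) := by
  unfold rotationIntegrand pencilCubic
  fun_prop

theorem rotationIntegrand_nonneg (a b l t : ℝ) : 0 ≤ rotationIntegrand a b l t := by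
  unfold rotationIntegrand
  positivity

/-- The branch points are at least `2 * δ` apart, so at each `t` at least two of the three linear
factors have modulus at least `δ`, leaving a single inverse square root singularity. -/
theorem intervalIntegrable_rotationIntegrand {a b l : ℝ} (hlb : l ≠ b) (hla : l ≠ a)
    (hba : b ≠ a) (u v : ℝ) : IntervalIntegrable (rotationIntegrand a b l) volume u v := by
  obtain ⟨δ, hδ, h1, h2, h3⟩ : ∃ δ > 0, 2 * δ ≤ |l - b| ∧ 2 * δ ≤ |l - a| ∧ 2 * δ ≤ |b - a| := by
    refine ⟨min |l - b| (min |l - a| |b - a|) / 2, ?_, ?_, ?_, ?_⟩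
    · have := abs_pos.2 (sub_ne_zero.2 hlb)
      have := abs_pos.2 (sub_ne_zero.2 hla)
      have := abs_pos.2 (sub_ne_zero.2 hba)
      positivity
    all_goals
      rw [mul_div_cancel₀ _ two_ne_zero]
      simp
  refine (((intervalIntegrable_one_div_sqrt_abs_sub l u v).add
    ((intervalIntegrable_one_div_sqrt_abs_sub b u v).add
      (intervalIntegrable_one_div_sqrt_abs_sub a u v))).const_mul δ⁻¹).mono_fun'
    (measurable_rotationIntegrand a b l).aestronglyMeasurable (.of_forall fun t => ?_)
  show ‖rotationIntegrand a b l t‖ ≤ δ⁻¹ * (1 / √|t - l| + (1 / √|t - b| + 1 / √|t - a|))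
  rw [Real.norm_of_nonneg (rotationIntegrand_nonneg a b l t)]
  have hl : 0 ≤ δ⁻¹ * (1 / √|t - l|) := by positivity
  have hb : 0 ≤ δ⁻¹ * (1 / √|t - b|) := by positivity
  have ha : 0 ≤ δ⁻¹ * (1 / √|t - a|) := by positivity
  have hprod : ∀ x y : ℝ, δ ≤ x → δ ≤ y → δ ^ 2 ≤ x * y := fun x y hx hy => by
    rw [sq]; exact mul_le_mul hx hy hδ.le (hδ.le.trans hx)
  simp only [rotationIntegrand, pencilCubic, abs_mul, mul_add, abs_sub_comm _ t]
  have t1 : |l - b| ≤ |t - l| + |t - b| := by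
    simpa [abs_sub_comm] using abs_sub_le l t b
  have t2 : |l - a| ≤ |t - l| + |t - a| := by
    simpa [abs_sub_comm] using abs_sub_le l t a
  have t3 : |b - a| ≤ |t - b| + |t - a| := by
    simpa [abs_sub_comm] using abs_sub_le b t a
  by_cases c1 : |t - l| < δ
  · have := one_div_sqrt_mul_le hδ (abs_nonneg (t - l))
      (hprod |t - b| |t - a| (by linarith) (by linarith))
    rw [mul_assoc]
    linarith
  · by_cases c2 : |t - b| < δ
    · have := one_div_sqrt_mul_le hδ (abs_nonneg (t - b))
        (hprod |t - l| |t - a| (by linarith) (by linarith))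
      rw [mul_comm |t - l|, mul_assoc]
      linarith
    · have := one_div_sqrt_mul_le hδ (abs_nonneg (t - a))
        (hprod |t - l| |t - b| (by linarith) (by linarith))
      rw [mul_comm]
      linarith

/-! ### Equality of the half-periods -/

/-- The period relation of the elliptic curve `y² = (l - t) (b - t) (a - t)`. -/
theorem integrableOn_Iic_and_integral_Iic_eq {a b l : ℝ} (hlb : l < b) (hba : b < a) :
    IntegrableOn (rotationIntegrand a b l) (Iic l) ∧
      ∫ t in Iic l, rotationIntegrand a b l t = ∫ t in b..a, rotationIntegrand a b l t := by
  -- The Möbius involution exchanging `∞` with `a` and `l` with `b`; it permutes the branch points,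
  -- hence preserves `dt / y` up to sign.
  set φ : ℝ → ℝ := fun x => a - (a - l) * (a - b) / (a - x) with hφ
  have hla : l < a := hlb.trans hba
  have hK : 0 < (a - l) * (a - b) := mul_pos (by linarith) (by linarith)
  have himg : φ '' Iio l = Ioo b a := by
    ext y
    constructor
    · rintro ⟨x, hx, rfl⟩
      have hx : x < l := hx
      have hx' : 0 < a - x := by linarith
      refine ⟨?_, ?_⟩
      · have : (a - l) * (a - b) / (a - x) < a - b := by
          rw [div_lt_iff₀ hx', mul_comm]
          exact mul_lt_mul_of_pos_left (by linarith) (by linarith)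
        simp only [hφ]; linarith
      · have : 0 < (a - l) * (a - b) / (a - x) := by positivity
        simp only [hφ]; linarith
    · rintro ⟨h1, h2⟩
      have hy : 0 < a - y := by linarith
      refine ⟨a - (a - l) * (a - b) / (a - y), ?_, ?_⟩
      · have : a - l < (a - l) * (a - b) / (a - y) := by
          rw [lt_div_iff₀ hy]
          exact mul_lt_mul_of_pos_left (by linarith) (by linarith)
        simp only [mem_Iio]; linarith
      · have : a - l ≠ 0 := by linarith
        have : a - b ≠ 0 := by linarith
        simp only [hφ]
        field_simp
        ring
  have hderiv : ∀ x ∈ Iio l,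
      HasDerivWithinAt φ (-((a - l) * (a - b) / (a - x) ^ 2)) (Iio l) x := by
    intro x hx
    have hx : x < l := hx
    have hx' : a - x ≠ 0 := by linarith
    have := ((((hasDerivAt_id x).const_sub a).fun_inv hx').const_mul
      ((a - l) * (a - b))).const_sub a
    refine (this.congr_deriv ?_).hasDerivWithinAt
    simp only [id]
    ring
  have hinj : InjOn φ (Iio l) := by
    intro x hx y hy hxy
    have hx : x < l := hx
    have hy : y < l := hy
    have hx' : a - x ≠ 0 := by linarith
    have hy' : a - y ≠ 0 := by linarith
    simp only [hφ, sub_right_inj] at hxy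
    rw [div_eq_div_iff hx' hy', mul_right_inj' hK.ne'] at hxy
    linarith
  have hcongr : ∀ x ∈ Iio l, |-((a - l) * (a - b) / (a - x) ^ 2)| •
      rotationIntegrand a b l (φ x) = rotationIntegrand a b l x := by
    intro x hx
    have hx : x < l := hx
    have hx' : 0 < a - x := by linarith
    -- The factor is the square of `φ'`, which cancels the Jacobian after taking the root.
    have h1 : pencilCubic a b l (φ x) =
        ((a - l) * (a - b) / (a - x) ^ 2) ^ 2 * pencilCubic a b l x := by
      simp only [pencilCubic, hφ]
      field_simp
      ring
    have h2 : 0 < (a - l) * (a - b) / (a - x) ^ 2 := by positivity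
    rw [abs_neg, abs_of_pos h2, rotationIntegrand, h1, abs_mul, abs_of_nonneg (sq_nonneg _),
      Real.sqrt_mul (sq_nonneg _), Real.sqrt_sq h2.le, smul_eq_mul, rotationIntegrand,
      ← one_div_mul_one_div, ← mul_assoc, mul_one_div_cancel h2.ne', one_mul]
  have hint := integrableOn_image_iff_integrableOn_abs_deriv_smul measurableSet_Iio hderiv hinj
    (rotationIntegrand a b l)
  have heq := integral_image_eq_integral_abs_deriv_smul measurableSet_Iio hderiv hinj
    (rotationIntegrand a b l)
  rw [himg] at hint heq
  rw [integrableOn_congr_fun hcongr measurableSet_Iio, ← integrableOn_Iic_iff_integrableOn_Iio] at hint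
  rw [setIntegral_congr_fun measurableSet_Iio hcongr, ← integral_Iic_eq_integral_Iio] at heq
  refine ⟨hint.1 ?_, ?_⟩
  · rw [← intervalIntegrable_iff_integrableOn_Ioo_of_le hba.le]
    exact intervalIntegrable_rotationIntegrand hlb.ne hla.ne hba.ne _ _
  · rw [← heq, intervalIntegral.integral_of_le hba.le, integral_Ioc_eq_integral_Ioo]

/-- Carries the period relation over to hyperbolas, where `b < l`. -/
theorem rotationIntegrand_symm (a b l : ℝ) : rotationIntegrand a b l = rotationIntegrand a l b := by
  funext t
  simp only [rotationIntegrand, pencilCubic, mul_comm (l - t)]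

/-! ### Weighted comparison of integrals -/

theorem sqrt_mul_one_div_sqrt_le {p q X Y : ℝ} (hX : 0 < X) (hY : 0 < Y)
    (h : p * Y ≤ q * X) : √p * (1 / √X) ≤ √q * (1 / √Y) := by
  rw [mul_one_div, mul_one_div, ← Real.sqrt_div' _ hX.le, ← Real.sqrt_div' _ hY.le]
  exact Real.sqrt_le_sqrt ((div_le_div_iff₀ hX hY).2 h)

theorem sqrt_mul_one_div_sqrt_lt {p q X Y : ℝ} (hp : 0 ≤ p) (hX : 0 < X) (hY : 0 < Y)
    (h : p * Y < q * X) : √p * (1 / √X) < √q * (1 / √Y) := by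
  rw [mul_one_div, mul_one_div, ← Real.sqrt_div' _ hX.le, ← Real.sqrt_div' _ hY.le]
  exact Real.sqrt_lt_sqrt (by positivity) ((div_lt_div_iff₀ hX hY).2 h)

/-- The weights `p`, `q` are meant to depend on the parameter; the pointwise comparison then reduces
to a polynomial inequality free of roots. -/
theorem sqrt_mul_integral_rotationIntegrand_lt {a b l m p q u v : ℝ} (hp : 0 ≤ p) (huv : u < v)
    (hl : IntervalIntegrable (rotationIntegrand a b l) volume u v)
    (hm : IntervalIntegrable (rotationIntegrand a b m) volume u v)
    (h : ∀ t ∈ Ioo u v, 0 < |pencilCubic a b l t| ∧ 0 < |pencilCubic a b m t| ∧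
      p * |pencilCubic a b m t| < q * |pencilCubic a b l t|) :
    √p * ∫ t in u..v, rotationIntegrand a b l t < √q * ∫ t in u..v, rotationIntegrand a b m t := by
  rw [← intervalIntegral.integral_const_mul, ← intervalIntegral.integral_const_mul, ← sub_pos,
    ← intervalIntegral.integral_sub (hm.const_mul _) (hl.const_mul _)]
  refine intervalIntegral.intervalIntegral_pos_of_pos_on
    ((hm.const_mul _).sub (hl.const_mul _)) (fun t ht => sub_pos.2 ?_) huv
  obtain ⟨h1, h2, h3⟩ := h t ht
  exact sqrt_mul_one_div_sqrt_lt hp h1 h2 h3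

theorem sqrt_mul_setIntegral_rotationIntegrand_le {a b l m p q : ℝ} {s : Set ℝ}
    (hs : MeasurableSet s) (hl : IntegrableOn (rotationIntegrand a b l) s)
    (hm : IntegrableOn (rotationIntegrand a b m) s)
    (h : ∀ t ∈ s, 0 < |pencilCubic a b l t| ∧ 0 < |pencilCubic a b m t| ∧
      p * |pencilCubic a b m t| ≤ q * |pencilCubic a b l t|) :
    √p * ∫ t in s, rotationIntegrand a b l t ≤ √q * ∫ t in s, rotationIntegrand a b m t := by
  rw [← integral_const_mul, ← integral_const_mul]
  refine setIntegral_mono_on (hl.const_mul _) (hm.const_mul _) hs fun t ht => ?_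
  obtain ⟨h1, h2, h3⟩ := h t ht
  exact sqrt_mul_one_div_sqrt_le h1 h2 h3

theorem rotationIntegrand_pos {a b l t : ℝ} (hl : t ≠ l) (hb : t ≠ b) (ha : t ≠ a) :
    0 < rotationIntegrand a b l t := by
  have : pencilCubic a b l t ≠ 0 :=
    mul_ne_zero (mul_ne_zero (sub_ne_zero.2 hl.symm) (sub_ne_zero.2 hb.symm))
      (sub_ne_zero.2 ha.symm)
  unfold rotationIntegrand
  positivity

theorem abs_pencilCubic_of_mem_Ioo {a b l t : ℝ} (hlb : l < b) (ht : t ∈ Ioo b a) :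
    0 < (t - b) * (a - t) ∧ 0 < t - l ∧
      |pencilCubic a b l t| = (t - l) * ((t - b) * (a - t)) := by
  have h1 : 0 < (t - b) * (a - t) := mul_pos (sub_pos.2 ht.1) (sub_pos.2 ht.2)
  have h2 : 0 < t - l := by linarith [ht.1]
  refine ⟨h1, h2, ?_⟩
  rw [← abs_of_pos (mul_pos h2 h1)]
  congr 1
  unfold pencilCubic
  ring

theorem abs_pencilCubic_of_lt {a b l t : ℝ} (hl : t < l) (hb : t < b) (ha : t < a) :
    0 < (b - t) * (a - t) ∧ 0 < l - t ∧ |pencilCubic a b l t| = (l - t) * ((b - t) * (a - t)) := by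
  have h1 : 0 < (b - t) * (a - t) := mul_pos (sub_pos.2 hb) (sub_pos.2 ha)
  have h2 : 0 < l - t := by linarith
  refine ⟨h1, h2, ?_⟩
  rw [← abs_of_pos (mul_pos h2 h1)]
  congr 1
  unfold pencilCubic
  ring

theorem integral_rotationIntegrand_strictMonoOn {a b : ℝ} (hba : b < a) :
    StrictMonoOn (fun l => ∫ t in b..a, rotationIntegrand a b l t) (Iio b) := by
  intro l hl m hm hlm
  have hl : l < b := hl
  have hm : m < b := hm
  have := sqrt_mul_integral_rotationIntegrand_lt zero_le_one hba
    (intervalIntegrable_rotationIntegrand hl.ne (hl.trans hba).ne hba.ne b a)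
    (intervalIntegrable_rotationIntegrand hm.ne (hm.trans hba).ne hba.ne b a) (q := 1) ?_
  · simpa using this
  intro t ht
  obtain ⟨h1, h2, h3⟩ := abs_pencilCubic_of_mem_Ioo hl ht
  obtain ⟨-, h4, h5⟩ := abs_pencilCubic_of_mem_Ioo hm ht
  rw [h3, h5]
  refine ⟨by positivity, by positivity, ?_⟩
  rw [one_mul, one_mul]
  exact mul_lt_mul_of_pos_right (by linarith) h1

theorem sqrt_mul_integral_rotationIntegrand_strictMonoOn {a b : ℝ} (hba : b < a) :
    StrictMonoOn (fun l => √(a - l) * ∫ t in b..a, rotationIntegrand a b l t) (Iio b) := by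
  intro l hl m hm hlm
  have hl : l < b := hl
  have hm : m < b := hm
  refine sqrt_mul_integral_rotationIntegrand_lt (by linarith) hba
    (intervalIntegrable_rotationIntegrand hl.ne (hl.trans hba).ne hba.ne b a)
    (intervalIntegrable_rotationIntegrand hm.ne (hm.trans hba).ne hba.ne b a) ?_
  intro t ht
  obtain ⟨h1, h2, h3⟩ := abs_pencilCubic_of_mem_Ioo hl ht
  obtain ⟨-, h4, h5⟩ := abs_pencilCubic_of_mem_Ioo hm ht
  rw [h3, h5]
  refine ⟨by positivity, by positivity, ?_⟩
  rw [← mul_assoc (a - l) (t - m), ← mul_assoc (a - m) (t - l)]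
  refine mul_lt_mul_of_pos_right ?_ h1
  nlinarith [mul_pos (sub_pos.2 hlm) (sub_pos.2 ht.2)]

/-! ### Positivity and splitting of the half-period -/

theorem integral_rotationIntegrand_pos {a b l u v : ℝ} (hlb : l ≠ b) (hla : l ≠ a) (hba : b ≠ a)
    (huv : u < v) (hl : l ∉ Ioo u v) (hb : b ∉ Ioo u v) (ha : a ∉ Ioo u v) :
    0 < ∫ t in u..v, rotationIntegrand a b l t :=
  intervalIntegral.intervalIntegral_pos_of_pos_on
    (intervalIntegrable_rotationIntegrand hlb hla hba u v)
    (fun _ ht => rotationIntegrand_pos (ne_of_mem_of_not_mem ht hl) (ne_of_mem_of_not_mem ht hb)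
      (ne_of_mem_of_not_mem ht ha)) huv

theorem integral_Iic_rotationIntegrand_pos {a b l c : ℝ} (hcl : c ≤ l) (hlb : l < b)
    (hba : b < a) : 0 < ∫ t in Iic c, rotationIntegrand a b l t := by
  have h1 : 0 < ∫ t in (c - 1)..c, rotationIntegrand a b l t :=
    integral_rotationIntegrand_pos hlb.ne (hlb.trans hba).ne hba.ne (by linarith)
      (fun h => by linarith [h.2]) (fun h => by linarith [h.2]) (fun h => by linarith [h.2])
  rw [intervalIntegral.integral_of_le (by linarith)] at h1
  refine h1.trans_le (setIntegral_mono_set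
    ((integrableOn_Iic_and_integral_Iic_eq hlb hba).1.mono_set (Iic_subset_Iic.2 hcl))
    (.of_forall fun t => rotationIntegrand_nonneg a b l t)
    (LE.le.eventuallyLE Ioc_subset_Iic_self))

theorem integral_Iic_add_integral {a b l c : ℝ} (hcl : c ≤ l) (hlb : l < b) (hba : b < a) :
    (∫ t in Iic c, rotationIntegrand a b l t) + ∫ t in c..l, rotationIntegrand a b l t =
      ∫ t in b..a, rotationIntegrand a b l t := by
  obtain ⟨h1, h2⟩ := integrableOn_Iic_and_integral_Iic_eq hlb hba
  rw [← h2, ← intervalIntegral.integral_Iic_sub_Iic (h1.mono_set (Iic_subset_Iic.2 hcl)) h1]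
  ring

theorem rotationNumber_of_lt {a b l : ℝ} (hlb : l < b) : rotationNumber a b l =
    (∫ t in (0 : ℝ)..l, rotationIntegrand a b l t) /
      (2 * ∫ t in b..a, rotationIntegrand a b l t) := by
  rw [rotationNumber, min_eq_right hlb.le, max_eq_left hlb.le]

theorem rotationNumber_of_gt {a b l : ℝ} (hlb : b < l) : rotationNumber a b l =
    (∫ t in (0 : ℝ)..b, rotationIntegrand a b l t) /
      (2 * ∫ t in l..a, rotationIntegrand a b l t) := by
  rw [rotationNumber, min_eq_left hlb.le, max_eq_right hlb.le]

/-! ### Ellipses with `0 ≤ l < b` -/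

theorem rotationNumber_strictMonoOn_Ico {a b : ℝ} (hba : b < a) :
    StrictMonoOn (rotationNumber a b) (Ico 0 b) := by
  intro l hl m hm hlm
  have hD := integral_rotationIntegrand_strictMonoOn hba hl.2 hm.2 hlm
  have hA : ∫ t in Iic 0, rotationIntegrand a b m t ≤ ∫ t in Iic 0, rotationIntegrand a b l t := by
    -- The endpoint is dropped because the cubic vanishes there when `l = 0`.
    rw [integral_Iic_eq_integral_Iio, integral_Iic_eq_integral_Iio]
    have := sqrt_mul_setIntegral_rotationIntegrand_le measurableSet_Iio
      ((integrableOn_Iic_and_integral_Iic_eq hm.2 hba).1.mono_set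
        (Iio_subset_Iic_self.trans (Iic_subset_Iic.2 hm.1)))
      ((integrableOn_Iic_and_integral_Iic_eq hl.2 hba).1.mono_set
        (Iio_subset_Iic_self.trans (Iic_subset_Iic.2 hl.1))) (p := 1) (q := 1) ?_
    · simpa using this
    intro t ht
    have ht : t < 0 := ht
    obtain ⟨h1, h2, h3⟩ := abs_pencilCubic_of_lt (a := a) (ht.trans_le hl.1)
      ((ht.trans_le hl.1).trans hl.2) (((ht.trans_le hl.1).trans hl.2).trans hba)
    obtain ⟨-, h4, h5⟩ := abs_pencilCubic_of_lt (ht.trans_le hm.1)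
      ((ht.trans_le hm.1).trans hm.2) (((ht.trans_le hm.1).trans hm.2).trans hba)
    rw [h3, h5]
    refine ⟨by positivity, by positivity, ?_⟩
    rw [one_mul, one_mul]
    exact mul_le_mul_of_nonneg_right (by linarith) h1.le
  have hpos := integral_Iic_rotationIntegrand_pos hl.1 hl.2 hba
  have hpos' := integral_Iic_rotationIntegrand_pos hm.1 hm.2 hba
  have el := integral_Iic_add_integral hl.1 hl.2 hba
  have em := integral_Iic_add_integral hm.1 hm.2 hba
  have hDl := integral_rotationIntegrand_pos hl.2.ne (hl.2.trans hba).ne hba.ne hba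
      (fun h => by linarith [h.1, hl.2]) (fun h => by linarith [h.1]) (fun h => by linarith [h.2])
  rw [rotationNumber_of_lt hl.2, rotationNumber_of_lt hm.2]
  simp only at hD
  rw [div_lt_div_iff₀ (by linarith) (by linarith), ← sub_eq_of_eq_add' el.symm,
    ← sub_eq_of_eq_add' em.symm]
  generalize (∫ t in b..a, rotationIntegrand a b l t) = D at *
  generalize (∫ t in b..a, rotationIntegrand a b m t) = E at *
  generalize (∫ t in Iic 0, rotationIntegrand a b l t) = A at *
  generalize (∫ t in Iic 0, rotationIntegrand a b m t) = B at *
  have h1 : B * D ≤ A * D := mul_le_mul_of_nonneg_right hA hDl.le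
  have h2 : A * D < A * E := mul_lt_mul_of_pos_left hD hpos
  linarith

/-! ### Hyperbolas -/

theorem rotationNumber_strictAntiOn_Ioo {a b : ℝ} (hb : 0 < b) :
    StrictAntiOn (rotationNumber a b) (Ioo b a) := by
  intro l hl m hm hlm
  have hl0 : 0 < l := hb.trans hl.1
  have hm0 : 0 < m := hb.trans hm.1
  have hba : b < a := hl.1.trans hl.2
  have hN : √m * ∫ t in (0 : ℝ)..b, rotationIntegrand a b m t <
      √l * ∫ t in (0 : ℝ)..b, rotationIntegrand a b l t := by
    refine sqrt_mul_integral_rotationIntegrand_lt hm0.le hb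
      (intervalIntegrable_rotationIntegrand hm.1.ne' hm.2.ne hba.ne 0 b)
      (intervalIntegrable_rotationIntegrand hl.1.ne' hl.2.ne hba.ne 0 b) ?_
    intro t ht
    obtain ⟨h1, h2, h3⟩ := abs_pencilCubic_of_lt (ht.2.trans hl.1) ht.2 (ht.2.trans hba)
    obtain ⟨-, h4, h5⟩ := abs_pencilCubic_of_lt (ht.2.trans hm.1) ht.2 (ht.2.trans hba)
    rw [h3, h5]
    refine ⟨by positivity, by positivity, ?_⟩
    rw [← mul_assoc m (l - t), ← mul_assoc l (m - t)]
    refine mul_lt_mul_of_pos_right ?_ h1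
    nlinarith [mul_pos (sub_pos.2 hlm) ht.1]
  have hint : ∀ k ∈ Ioo b a, IntegrableOn (rotationIntegrand a b k) (Iic 0) := fun k hk => by
    rw [rotationIntegrand_symm]
    exact (integrableOn_Iic_and_integral_Iic_eq hk.1 hk.2).1.mono_set (Iic_subset_Iic.2 hb.le)
  have hA : √l * ∫ t in Iic 0, rotationIntegrand a b l t ≤
      √m * ∫ t in Iic 0, rotationIntegrand a b m t := by
    refine sqrt_mul_setIntegral_rotationIntegrand_le measurableSet_Iic (hint l hl)
      (hint m hm) ?_
    intro t ht
    have ht : t ≤ 0 := ht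
    have htb : t < b := ht.trans_lt hb
    obtain ⟨h1, h2, h3⟩ := abs_pencilCubic_of_lt (htb.trans hl.1) htb (htb.trans hba)
    obtain ⟨-, h4, h5⟩ := abs_pencilCubic_of_lt (htb.trans hm.1) htb (htb.trans hba)
    rw [h3, h5]
    refine ⟨by positivity, by positivity, ?_⟩
    rw [← mul_assoc l (m - t), ← mul_assoc m (l - t)]
    refine mul_le_mul_of_nonneg_right ?_ h1.le
    nlinarith [mul_nonneg (sub_pos.2 hlm).le (neg_nonneg.2 ht)]
  have hAl := integral_Iic_rotationIntegrand_pos hb.le hl.1 hl.2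
  have hAm := integral_Iic_rotationIntegrand_pos hb.le hm.1 hm.2
  have el := integral_Iic_add_integral hb.le hl.1 hl.2
  have em := integral_Iic_add_integral hb.le hm.1 hm.2
  rw [← rotationIntegrand_symm] at hAl hAm el em
  have hNpos : ∀ k ∈ Ioo b a, 0 < ∫ t in (0 : ℝ)..b, rotationIntegrand a b k t := fun k hk =>
    integral_rotationIntegrand_pos hk.1.ne' hk.2.ne hba.ne hb
      (fun h => by linarith [h.2, hk.1]) (fun h => by linarith [h.2]) (fun h => by linarith [h.2])
  have hNl := hNpos l hl
  have hNm := hNpos m hm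
  rw [rotationNumber_of_gt hl.1, rotationNumber_of_gt hm.1, ← el, ← em,
    div_lt_div_iff₀ (by linarith) (by linarith)]
  have hsl : 0 < √l := Real.sqrt_pos.2 hl0
  have hsm : 0 < √m := Real.sqrt_pos.2 hm0
  generalize (∫ t in (0 : ℝ)..b, rotationIntegrand a b l t) = N at *
  generalize (∫ t in (0 : ℝ)..b, rotationIntegrand a b m t) = M at *
  generalize (∫ t in Iic 0, rotationIntegrand a b l t) = A at *
  generalize (∫ t in Iic 0, rotationIntegrand a b m t) = B at *
  have key : M * A < N * B := by
    refine lt_of_mul_lt_mul_left ?_ (mul_pos hsl hsm).le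
    calc √l * √m * (M * A) = √m * M * (√l * A) := by ring
      _ < √l * N * (√l * A) := mul_lt_mul_of_pos_right hN (mul_pos hsl hAl)
      _ ≤ √l * N * (√m * B) := mul_le_mul_of_nonneg_left hA (mul_pos hsl hNl).le
      _ = √l * √m * (N * B) := by ring
  linarith

/-! ### Ellipses with `l ≤ 0` -/

theorem sqrt_mul_integral_zero_monotoneOn {a b : ℝ} (hb : 0 < b) (hba : b < a) :
    MonotoneOn (fun l => √(a - l) * ∫ t in (0 : ℝ)..l, rotationIntegrand a b l t) (Iio 0) := by
  -- The substitution `t = s * l` fixes the interval; `|l|` enters the root as `l ^ 2`, and `l < 0`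
  -- gives the sign.
  have hscale : ∀ l < (0 : ℝ), √(a - l) * ∫ t in (0 : ℝ)..l, rotationIntegrand a b l t =
      -∫ s in (0 : ℝ)..1, √(l ^ 2 * (a - l)) * rotationIntegrand a b l (s * l) := by
    intro l hl
    have := intervalIntegral.smul_integral_comp_mul_right (a := 0) (b := 1)
      (rotationIntegrand a b l) l
    rw [zero_mul, one_mul, smul_eq_mul] at this
    rw [intervalIntegral.integral_const_mul, ← this, Real.sqrt_mul (sq_nonneg l),
      Real.sqrt_sq_eq_abs, abs_of_neg hl]
    ring
  have hint : ∀ l < (0 : ℝ), IntervalIntegrable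
      (fun s => √(l ^ 2 * (a - l)) * rotationIntegrand a b l (s * l)) volume 0 1 := by
    intro l hl
    have := (intervalIntegrable_rotationIntegrand (hl.trans hb).ne (hl.trans (hb.trans hba)).ne
      hba.ne 0 l).comp_mul_right (c := l)
    rw [zero_div, div_self hl.ne] at this
    exact this.const_mul _
  intro l hl m hm hlm
  have hl : l < 0 := hl
  have hm : m < 0 := hm
  simp only [hscale l hl, hscale m hm, neg_le_neg_iff]
  refine intervalIntegral.integral_mono_on_of_le_Ioo zero_le_one (hint m hm) (hint l hl) ?_
  intro s hs
  have habs : ∀ k < (0 : ℝ), 0 < (b - s * k) * (a - s * k) * ((1 - s) * -k) ∧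
      |pencilCubic a b k (s * k)| = (b - s * k) * (a - s * k) * ((1 - s) * -k) := by
    intro k hk
    have h0 : 0 < -(s * k) := by
      rw [← mul_neg]; exact mul_pos hs.1 (neg_pos.2 hk)
    have h1 : 0 < (b - s * k) * (a - s * k) * ((1 - s) * -k) :=
      mul_pos (mul_pos (by linarith) (by linarith)) (mul_pos (by linarith [hs.2]) (by linarith))
    refine ⟨h1, ?_⟩
    rw [← abs_of_pos h1, ← abs_neg]
    congr 1
    unfold pencilCubic
    ring
  obtain ⟨h1, h2⟩ := habs l hl
  obtain ⟨h3, h4⟩ := habs m hm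
  rw [rotationIntegrand, rotationIntegrand, h2, h4]
  refine sqrt_mul_one_div_sqrt_le h3 h1 ?_
  have hsl : 0 ≤ -(s * l) := by rw [← mul_neg]; exact mul_nonneg hs.1.le (by linarith)
  have hsm : 0 ≤ -(s * m) := by rw [← mul_neg]; exact mul_nonneg hs.1.le (by linarith)
  -- Up to `1 - s`, the squared integrand is the product of `-l / (b - s * l)` and `(a - l) / (a - s
  -- * l)`, both nonincreasing in `l`.
  have e1 : -m * (b - s * l) ≤ -l * (b - s * m) := by
    nlinarith [mul_nonneg hb.le (sub_nonneg.2 hlm)]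
  have e2 : (a - m) * (a - s * l) ≤ (a - l) * (a - s * m) := by
    nlinarith [mul_nonneg (mul_nonneg (hb.trans hba).le (sub_nonneg.2 hlm)) (sub_pos.2 hs.2).le]
  have e3 : -m * (b - s * l) * ((a - m) * (a - s * l)) ≤
      -l * (b - s * m) * ((a - l) * (a - s * m)) :=
    mul_le_mul e1 e2 (mul_nonneg (by linarith) (by linarith))
      (mul_nonneg (by linarith) (by linarith))
  have e4 : 0 ≤ -m * -l * (1 - s) :=
    mul_nonneg (mul_nonneg (by linarith) (by linarith)) (by linarith [hs.2])
  have e5 := mul_le_mul_of_nonneg_left e3 e4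
  linarith

theorem rotationNumber_strictMonoOn_Iic {a b : ℝ} (hb : 0 < b) (hba : b < a) :
    StrictMonoOn (rotationNumber a b) (Iic 0) := by
  intro l hl m hm hlm
  have hm : m ≤ 0 := hm
  have hl : l < 0 := hlm.trans_le hm
  have hlb : l < b := hl.trans hb
  have hmb : m < b := hm.trans_lt hb
  have hDl := integral_rotationIntegrand_pos hlb.ne (hlb.trans hba).ne hba.ne hba
    (fun h => by linarith [h.1]) (fun h => by linarith [h.1]) (fun h => by linarith [h.2])
  have hDm := integral_rotationIntegrand_pos hmb.ne (hmb.trans hba).ne hba.ne hba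
    (fun h => by linarith [h.1]) (fun h => by linarith [h.1]) (fun h => by linarith [h.2])
  have hN : ∫ t in (0 : ℝ)..l, rotationIntegrand a b l t < 0 := by
    rw [intervalIntegral.integral_symm, neg_lt_zero]
    exact integral_rotationIntegrand_pos hlb.ne (hlb.trans hba).ne hba.ne hl
      (fun h => by linarith [h.1]) (fun h => by linarith [h.2]) (fun h => by linarith [h.2])
  have hsl : 0 < √(a - l) := Real.sqrt_pos.2 (by linarith)
  have hsm : 0 < √(a - m) := Real.sqrt_pos.2 (by linarith)
  have hNs : √(a - l) * ∫ t in (0 : ℝ)..l, rotationIntegrand a b l t ≤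
      √(a - m) * ∫ t in (0 : ℝ)..m, rotationIntegrand a b m t := by
    -- The rescaling degenerates at `m = 0`, where the numerator is zero. A weak inequality
    -- suffices, since the one for the denominators is strict and `N < 0`.
    rcases hm.eq_or_lt with rfl | hm
    · rw [intervalIntegral.integral_same, mul_zero]
      exact (mul_neg_of_pos_of_neg hsl hN).le
    · exact sqrt_mul_integral_zero_monotoneOn hb hba hl hm hlm.le
  have hD := sqrt_mul_integral_rotationIntegrand_strictMonoOn hba hlb hmb hlm
  simp only at hD
  rw [rotationNumber_of_lt hlb, rotationNumber_of_lt hmb,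
    div_lt_div_iff₀ (by linarith) (by linarith)]
  generalize (∫ t in (0 : ℝ)..l, rotationIntegrand a b l t) = N at *
  generalize (∫ t in (0 : ℝ)..m, rotationIntegrand a b m t) = M at *
  generalize (∫ t in b..a, rotationIntegrand a b l t) = D at *
  generalize (∫ t in b..a, rotationIntegrand a b m t) = E at *
  have key : N * E < M * D := by
    refine lt_of_mul_lt_mul_left ?_ (mul_pos hsl hsm).le
    calc √(a - l) * √(a - m) * (N * E) = √(a - l) * N * (√(a - m) * E) := by ring
      _ < √(a - l) * N * (√(a - l) * D) :=
        mul_lt_mul_of_neg_left hD (mul_neg_of_pos_of_neg hsl hN)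
      _ ≤ √(a - m) * M * (√(a - l) * D) := mul_le_mul_of_nonneg_right hNs (mul_pos hsl hDl).le
      _ = √(a - l) * √(a - m) * (M * D) := by ring
  linarith

theorem mainTheorem11 (a b : ℝ) (hb : 0 < b) (hab : b < a) :
    (∀ l ∈ Iio b ∪ Ioo b a,
      IntervalIntegrable (rotationIntegrand a b l) volume 0 (min b l) ∧
      IntervalIntegrable (rotationIntegrand a b l) volume (max b l) a ∧
      0 < ∫ t in (max b l)..a, rotationIntegrand a b l t) ∧
    (StrictMonoOn (rotationNumber a b) (Iio b) ∨ StrictAntiOn (rotationNumber a b) (Iio b)) ∧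
    (StrictMonoOn (rotationNumber a b) (Ioo b a) ∨ StrictAntiOn (rotationNumber a b) (Ioo b a)) := by
  refine ⟨fun l hl => ?_, Or.inl ?_, Or.inr (rotationNumber_strictAntiOn_Ioo hb)⟩
  · have hlb : l ≠ b := by
      rcases hl with hl | hl
      · exact ne_of_lt hl
      · exact hl.1.ne'
    have hla : l < a := by
      rcases hl with hl | hl
      · exact lt_trans hl hab
      · exact hl.2
    have hint := intervalIntegrable_rotationIntegrand hlb hla.ne hab.ne
    refine ⟨hint _ _, hint _ _, integral_rotationIntegrand_pos hlb hla.ne hab.ne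
      (max_lt hab hla) (fun h => ?_) (fun h => ?_) (fun h => ?_)⟩
    · exact (le_max_right b l).not_gt h.1
    · exact (le_max_left b l).not_gt h.1
    · exact lt_irrefl a h.2
  -- Both ranges contain `0`, so strict monotonicity glues there.
  · rw [← Iic_union_Ico_eq_Iio hb]
    exact (rotationNumber_strictMonoOn_Iic hb hab).union (rotationNumber_strictMonoOn_Ico hab)
      isGreatest_Iic (isLeast_Ico hb)
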